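/- Let $\chi_1$ and $\chi_2$ be nontrivial primitive Dirichlet characters modulo $q_1$ and $q_2$, respectively, such that $\chi_1(-1)\chi_2(-1)=1$, and let $c\ge 1$ be an integer with $q_1q_2\mid c$. Let $B_1(x)=0$ if $x\in\mathbb{Z}$ and $B_1(x)=x-\lfloor x\rfloor-\tfrac12$ otherwise, and for an integer $a$ coprime to $c$ let \[ S_{\chi_1,\chi_2}(a,c)=\sum_{j \bmod c}\ \sum_{n \bmod q_1}\overline{\chi_2}(j)\,\overline{\chi_1}(n)\,B_1\!\left(\frac{j}{c}\right)B_1\!\left(\frac{n}{q_1}+\frac{aj}{c}\right). \] For a Dirichlet character $\chi$ modulo $q$, write $\chi^\star$ for the primitive character that induces $\chi$, $q(\chi)$ for its conductor, and $\tau(\chi)=\sum_{n \bmod q}\chi(n)e^{2\pi i n/q}$ for its Gauss sum. Let $\ast$ denote Dirichlet convolution, $\mu$ the Möbius function and $\varphi$ Euler's function. A product of characters of different moduli is a character modulo the least common multiple of the moduli. Then \[ \sum_{\substack{a \bmod c\\ (a,c)=1}}\lvert S_{\chi_1,\chi_2}(a,c)\rvert^2 =\frac{\varphi(c)}{\pi^4}\sum_{\substack{\psi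 \bmod c\\ \psi(-1)\chi_1(-1)=-1}} \lvert L(1,\overline{\psi}^{\,\star}\chi_1)\rvert^2\,\lvert L(1,(\psi\chi_2)^\star)\rvert^2\,\lvert g_{\chi_1,\chi_2}(\psi;c)\rvert^2, \] where $\psi$ runs over the Dirichlet characters modulo $c$ and \[ g_{\chi_1,\chi_2}(\psi;c)=\tau\big((\overline{\psi\chi_2})^\star\big)\,\tau(\psi^\star)\,\tau(\overline{\chi_1}) \sum_{\substack{d\mid c\\ q(\psi)\mid d}}\frac{\overline{\chi_2}(c/d)}{\varphi(d)}\, \big((\overline{\psi\chi_2})^\star\mu\ast 1\big)(d)\,\big(\chi_1\ast\mu\psi^\star\big)\!\left(\frac{d}{q(\psi)}\right). \] -/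

import Mathlib

open scoped ArithmeticFunction.Moebius

/-- The level of a product of two Dirichlet characters of positive levels is positive. -/
instance instNeZeroLcmLevel (m n : ℕ) [NeZero m] [NeZero n] : NeZero (Nat.lcm m n) :=
  ⟨Nat.lcm_ne_zero (NeZero.ne m) (NeZero.ne n)⟩

/-- The conductor of a Dirichlet character of positive level is positive. -/
instance instNeZeroConductor {n : ℕ} [NeZero n] (χ : DirichletCharacter ℂ n) :
    NeZero χ.conductor :=
  ⟨χ.conductor_ne_zero⟩

namespace DedekindSum

/-- The first Bernoulli function: `0` at integers, `x - ⌊x⌋ - 1/2` elsewhere. -/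
noncomputable def B₁ (x : ℝ) : ℝ :=
  if Int.fract x = 0 then 0 else x - ⌊x⌋ - 1 / 2

/-- The Gauss sum `τ(χ) = ∑_{n mod q} χ(n) exp(2πi n/q)`. -/
noncomputable def tau {q : ℕ} [NeZero q] (χ : DirichletCharacter ℂ q) : ℂ :=
  gaussSum χ ZMod.stdAddChar

/-- The generalized Dedekind sum
`S_{χ₁,χ₂}(a,c) = ∑_{j mod c} ∑_{n mod q₁} conj χ₂(j) conj χ₁(n) B₁(j/c) B₁(n/q₁ + aj/c)`. -/
noncomputable def S {q₁ q₂ : ℕ} (χ₁ : DirichletCharacter ℂ q₁) (χ₂ : DirichletCharacter ℂ q₂)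
    (a : ℤ) (c : ℕ) : ℂ :=
  ∑ j ∈ Finset.range c, ∑ n ∈ Finset.range q₁,
    starRingEnd ℂ (χ₂ (j : ZMod q₂)) * starRingEnd ℂ (χ₁ (n : ZMod q₁)) *
      ((B₁ ((j : ℝ) / c) * B₁ ((n : ℝ) / q₁ + (a : ℝ) * j / c) : ℝ) : ℂ)

/-- The factor `g_{χ₁,χ₂}(ψ;c)`. Here `ψ⁻¹` is the complex conjugate of the character `ψ`,
`ψ.mul χ` is the pointwise product of characters of possibly different levels (a character modulo
the least common multiple of the levels), `χ.primitiveCharacter` is the primitive character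
inducing `χ`, and `LSeries.convolution` is Dirichlet convolution. -/
noncomputable def g {q₁ q₂ c : ℕ} [NeZero q₁] [NeZero q₂] [NeZero c]
    (χ₁ : DirichletCharacter ℂ q₁) (χ₂ : DirichletCharacter ℂ q₂)
    (ψ : DirichletCharacter ℂ c) : ℂ :=
  tau (ψ.mul χ₂)⁻¹.primitiveCharacter * tau ψ.primitiveCharacter * tau χ₁⁻¹ *
    ∑ d ∈ c.divisors with ψ.conductor ∣ d,
      starRingEnd ℂ (χ₂ ((c / d : ℕ) : ZMod q₂)) / (d.totient : ℂ) *
        LSeries.convolution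
          (fun n : ℕ => (ψ.mul χ₂)⁻¹.primitiveCharacter (n : ZMod _) * ((μ n : ℤ) : ℂ))
          (fun _ => 1) d *
        LSeries.convolution
          (fun n : ℕ => χ₁ (n : ZMod q₁))
          (fun n : ℕ => ((μ n : ℤ) : ℂ) * ψ.primitiveCharacter (n : ZMod _))
          (d / ψ.conductor)

end DedekindSum

/-!
The identity is Parseval's formula for the characters of the unit group modulo `c`
(`sum_norm_sq_eq_sum_characters`), once the coefficients `∑ ψ(a) S(a, c)` of the Dedekind sum have
been computed. As `B₁` is odd, the coefficient vanishes unless `ψ χ₁` is odd (`coeff_eq_zero`).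
Otherwise it equals `-φ(c) π⁻² L(1, conj ψ* χ₁) L(1, (ψ χ₂)*) g(ψ; c)` (`pi_sq_mul_coeff`).

To see this, sort the residues `j` modulo `c` as `j = (c / d) k` with `d ∣ c` and `k` coprime to
`d`. The inner sum then depends on `a` modulo `d` only, so the sum over `a` vanishes unless the
conductor of `ψ` divides `d` (`sum_units_char_mul_comp_unitsMap`), and otherwise the variables `k`
and `a k` separate. What remains for each `d` is a product of a sum of `B₁(k / d)` against the
character `conj (ψ χ₂)`, and a sum of `B₁(n / q₁ + b / d)` against `conj χ₁(n) ψ(b)`.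

Both are instances of one formula, `pi_mul_sum_changeLevel_mul_sum_circleB₁`, the first with the
trivial character modulo `1` in place of `χ₁`. Its proof has two steps.
* `sum_changeLevel_mul_sum_circleB₁`: Möbius inversion of the coprimality condition, the
  distribution relation `∑ B₁(y + t / f) = B₁(f y)`, and the primitivity of `χ₁` replace the
  character modulo `d` by the primitive character inducing it. This produces the finite Dirichlet
  convolutions in `g`.
* `sum_char_mul_circleB₁`: for primitive characters, the Fourier expansion of `B₁` turns the sum
  into two Gauss sums times an `L`-value at `1`.

The Fourier series of `B₁` converges only conditionally. It is therefore used in the form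
`sinZeta x 1 = -π B₁(x)` (`sinZeta_one`), where `sinZeta` is defined at `1` by continuation: the
identities between Dirichlet series are proved for `1 < re s` and carried to `s = 1` by continuity,
and the value at `1` comes from writing `Γ(s) ∑ zⁿ / nˢ` as a Mellin transform.
-/

/-! ### The first Bernoulli function and the sine zeta function at `1` -/

namespace DedekindSum
open Complex Filter Topology Set HurwitzZeta

/-- Two functions continuous at `1` that agree on the half-plane `1 < re s` agree at `1`. -/
lemma eq_at_one_of_eq_on_one_lt_re {f g : ℂ → ℂ} (hf : ContinuousAt f 1) (hg : ContinuousAt g 1)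
    (h : ∀ s : ℂ, 1 < s.re → f s = g s) : f 1 = g 1 := by
  have hu : Tendsto (fun x : ℝ ↦ (x : ℂ)) (𝓝[>] 1) (𝓝 1) :=
    (continuous_ofReal.tendsto' 1 1 ofReal_one).mono_left nhdsWithin_le_nhds
  refine tendsto_nhds_unique_of_eventuallyEq (hf.tendsto.comp hu) (hg.tendsto.comp hu) ?_
  filter_upwards [self_mem_nhdsWithin] with x hx
  exact h x (by simpa using hx)

/-- This keeps `1 - z e^(-t)` away from zero and from the branch cut of the logarithm. -/
lemma re_one_sub_pos {z : ℂ} (hz : ‖z‖ = 1) (hz1 : z ≠ 1) {t : ℝ} (ht : 0 ≤ t) :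
    0 < (1 - z * (Real.exp (-t) : ℂ)).re := by
  have h1 : z.re < 1 := by
    refine lt_of_le_of_ne (hz ▸ z.re_le_norm) fun h ↦ hz1 ?_
    have := Complex.sq_norm z
    rw [hz, Complex.normSq_apply, h] at this
    exact Complex.ext h (by simpa using this)
  have h2 : Real.exp (-t) ≤ 1 := Real.exp_le_one_iff.mpr (by linarith)
  have h3 := Real.exp_pos (-t)
  simp only [sub_re, one_re, re_mul_ofReal]
  nlinarith

/-- The closed form of `∑ zⁿ e^(-nt)`, the sum being over `n ≥ 1`. For `z` on the unit circle its
Mellin transform is `Γ(s) ∑ zⁿ / nˢ`. -/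
noncomputable def polylogKernel (z : ℂ) (t : ℝ) : ℂ :=
  z * (Real.exp (-t) : ℂ) / (1 - z * (Real.exp (-t) : ℂ))

lemma continuousOn_polylogKernel {z : ℂ} (hz : ‖z‖ = 1) (hz1 : z ≠ 1) :
    ContinuousOn (polylogKernel z) (Ici 0) := by
  unfold polylogKernel
  refine ContinuousOn.div (by fun_prop) (by fun_prop) fun t ht h ↦ ?_
  exact (re_one_sub_pos hz hz1 ht).ne' (by rw [h, zero_re])

lemma tendsto_ofReal_exp_neg_atTop :
    Tendsto (fun t : ℝ ↦ (Real.exp (-t) : ℂ)) atTop (𝓝 0) := by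
  simpa only [ofReal_zero, Function.comp_def] using (continuous_ofReal.tendsto 0).comp
    (Real.tendsto_exp_atBot.comp tendsto_neg_atTop_atBot)

lemma polylogKernel_isBigO_atTop (z : ℂ) :
    polylogKernel z =O[atTop] fun t : ℝ ↦ Real.exp (-1 * t) := by
  have h0 := tendsto_ofReal_exp_neg_atTop
  have h1 : Tendsto (fun t : ℝ ↦ z / (1 - z * (Real.exp (-t) : ℂ))) atTop (𝓝 (z / (1 - z * 0))) :=
    tendsto_const_nhds.div (tendsto_const_nhds.sub (tendsto_const_nhds.mul h0)) (by simp)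
  have h3 : (fun t : ℝ ↦ (Real.exp (-t) : ℂ)) =O[atTop] fun t : ℝ ↦ Real.exp (-1 * t) :=
    Asymptotics.isBigO_of_le _ fun t ↦ by simp [-ofReal_exp]
  refine ((h1.isBigO_one ℝ).mul h3).congr (fun t ↦ ?_) fun t ↦ one_mul _
  rw [polylogKernel]; ring

lemma polylogKernel_isBigO_zero {z : ℂ} (hz : ‖z‖ = 1) (hz1 : z ≠ 1) :
    polylogKernel z =O[𝓝[>] 0] fun t : ℝ ↦ t ^ (-(0 : ℝ)) := by
  have h := ((continuousOn_polylogKernel hz hz1) 0 self_mem_Ici).mono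
    (Ioi_subset_Ici_self)
  simpa using h.tendsto.isBigO_one ℝ

/-- An antiderivative of the kernel is `log (1 - z e^(-t))`. -/
lemma mellin_polylogKernel_one {z : ℂ} (hz : ‖z‖ = 1) (hz1 : z ≠ 1) :
    mellin (polylogKernel z) 1 = -Complex.log (1 - z) := by
  have hint : MellinConvergent (polylogKernel z) 1 := by
    refine mellinConvergent_of_isBigO_rpow_exp (a := 1) (b := 0) one_pos ?_
      (polylogKernel_isBigO_atTop z) (polylogKernel_isBigO_zero hz hz1) (by simp)
    exact ((continuousOn_polylogKernel hz hz1).mono Ioi_subset_Ici_self).locallyIntegrableOn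
      measurableSet_Ioi
  have hderiv (t : ℝ) (ht : 0 ≤ t) :
      HasDerivAt (fun t : ℝ ↦ Complex.log (1 - z * (Real.exp (-t) : ℂ))) (polylogKernel z t) t := by
    have h1 : HasDerivAt (fun t : ℝ ↦ (Real.exp (-t) : ℂ)) ((Real.exp (-t) * (-1) : ℝ) : ℂ) t :=
      ((hasDerivAt_neg t).exp).ofReal_comp
    have h2 := ((h1.const_mul z).const_sub 1).clog_real
      (Or.inl (re_one_sub_pos hz hz1 ht))
    convert h2 using 1
    rw [polylogKernel]; push_cast; ring
  have htend : Tendsto (fun t : ℝ ↦ Complex.log (1 - z * (Real.exp (-t) : ℂ))) atTop (𝓝 0) := by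
    have h0 := tendsto_ofReal_exp_neg_atTop
    have h1 : Tendsto (fun t : ℝ ↦ 1 - z * (Real.exp (-t) : ℂ)) atTop (𝓝 1) := by
      simpa using tendsto_const_nhds.sub ((tendsto_const_nhds (x := z)).mul h0)
    simpa using h1.clog (by simp)
  have hint' : MeasureTheory.IntegrableOn (polylogKernel z) (Ioi 0) := by
    simpa [MellinConvergent] using hint
  have := MeasureTheory.integral_Ioi_of_hasDerivAt_of_tendsto
    (hderiv 0 le_rfl).continuousAt.continuousWithinAt (fun t ht ↦ hderiv t (le_of_lt ht)) hint' htend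
  simpa [mellin] using this

lemma Gamma_mul_expZeta (a : ℝ) {s : ℂ} (hs : 1 < s.re) :
    Complex.Gamma s * expZeta a s = mellin (polylogKernel (cexp (2 * Real.pi * I * a))) s := by
  set z := cexp (2 * Real.pi * I * a) with hz
  have hz1 : ‖z‖ = 1 := by
    rw [hz, show (2 * Real.pi * I * a : ℂ) = ((2 * Real.pi * a : ℝ) : ℂ) * I by push_cast; ring]
    exact Complex.norm_exp_ofReal_mul_I _
  have h1 : HasSum (fun i : ℕ ↦ Complex.Gamma s * z ^ (i + 1) / (((i : ℝ) + 1 : ℝ) : ℂ) ^ s)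
      (mellin (polylogKernel z) s) := by
    refine hasSum_mellin (fun i ↦ Or.inr (by positivity)) (by linarith) (fun t ht ↦ ?_) ?_
    · have hw : ‖z * (Real.exp (-t) : ℂ)‖ < 1 := by
        rw [norm_mul, hz1, one_mul, Complex.norm_real, Real.norm_eq_abs, Real.abs_exp]
        exact Real.exp_lt_one_iff.mpr (by simpa using ht)
      refine ((hasSum_geometric_of_norm_lt_one hw).mul_left (z * (Real.exp (-t) : ℂ))).congr_fun
        fun i ↦ ?_
      rw [← pow_succ', mul_pow, ← ofReal_pow, ← Real.exp_nat_mul]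
      congr 3
      push_cast; ring
    · simp only [norm_pow, hz1, one_pow]
      have := (Real.summable_one_div_nat_rpow.mpr hs)
      simpa using (summable_nat_add_iff 1).mpr this
  have hs0 : s ≠ 0 := fun h ↦ by simp [h] at hs; linarith
  have h2 := (hasSum_expZeta_of_one_lt_re a hs).mul_left (Complex.Gamma s)
  rw [← hasSum_nat_add_iff' 1] at h2
  simp only [Finset.range_one, Finset.sum_singleton, Nat.cast_zero, zero_cpow hs0, div_zero,
    mul_zero, sub_zero] at h2
  refine h2.unique (h1.congr_fun fun i ↦ ?_)
  rw [hz, ← Complex.exp_nat_mul, mul_div_assoc]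
  push_cast
  ring_nf

lemma one_sub_exp_eq (a : ℝ) : 1 - cexp (2 * Real.pi * I * a) =
    ((2 * Real.sin (Real.pi * a) : ℝ) : ℂ) *
      cexp (((Real.pi * a - Real.pi / 2 : ℝ) : ℂ) * I) := by
  have h1 : cexp (2 * Real.pi * I * a) = cexp ((Real.pi * a : ℝ) * I) ^ 2 := by
    rw [← Complex.exp_nat_mul]; push_cast; ring_nf
  have h2 : cexp (((Real.pi * a - Real.pi / 2 : ℝ) : ℂ) * I) =
      -I * cexp ((Real.pi * a : ℝ) * I) := by
    push_cast
    rw [sub_mul, Complex.exp_sub, Complex.exp_pi_div_two_mul_I, div_eq_mul_inv, inv_I]; ring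
  rw [h1, h2, Complex.exp_mul_I, ← Complex.ofReal_cos, ← Complex.ofReal_sin]
  have h3 : ((Real.cos (Real.pi * a) : ℝ) : ℂ) ^ 2 + (Real.sin (Real.pi * a) : ℂ) ^ 2 = 1 := by
    exact_mod_cast Real.cos_sq_add_sin_sq (Real.pi * a)
  push_cast at h3 ⊢
  linear_combination (-1 : ℂ) * h3 + ((Complex.sin (Real.pi * a)) ^ 2 * 2 
    - (Complex.sin (Real.pi * a)) ^ 2) * I_sq

/-- The value at `1` of the exponential zeta function is `-log (1 - e^(2πia))`, here with the
logarithm split into real and imaginary parts. -/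
lemma expZeta_one {a : ℝ} (ha : a ∈ Ioo (0 : ℝ) 1) :
    expZeta a 1 = -(Real.log (2 * Real.sin (Real.pi * a)) : ℂ) -
      ((Real.pi * a - Real.pi / 2 : ℝ) : ℂ) * I := by
  have hpi := Real.pi_pos
  set z := cexp (2 * Real.pi * I * a) with hz
  have hnorm : ‖z‖ = 1 := by
    rw [hz, show (2 * Real.pi * I * a : ℂ) = ((2 * Real.pi * a : ℝ) : ℂ) * I by push_cast; ring]
    exact Complex.norm_exp_ofReal_mul_I _
  have hsin : 0 < 2 * Real.sin (Real.pi * a) := by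
    have := Real.sin_pos_of_pos_of_lt_pi (mul_pos hpi ha.1) (by nlinarith [ha.2])
    positivity
  have hz1 : z ≠ 1 := fun h ↦ by
    have h0 := one_sub_exp_eq a
    rw [← hz, h, sub_self, eq_comm, mul_eq_zero, or_iff_left (Complex.exp_ne_zero _)] at h0
    exact hsin.ne' (by exact_mod_cast h0)
  have ha0 : (a : UnitAddCircle) ≠ 0 := fun h ↦ by
    obtain ⟨n, hn⟩ := (AddCircle.coe_eq_zero_iff (1 : ℝ)).mp h
    simp only [zsmul_eq_mul, mul_one] at hn
    have h1 : (0 : ℝ) < n := hn ▸ ha.1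
    have h2 : (n : ℝ) < 1 := hn ▸ ha.2
    norm_cast at h1 h2
    omega
  have hcont : ContinuousAt (mellin (polylogKernel z)) 1 := by
    refine (mellin_differentiableAt_of_isBigO_rpow_exp (a := 1) (b := 0) one_pos ?_
      (polylogKernel_isBigO_atTop z) (polylogKernel_isBigO_zero hnorm hz1) (by simp)).continuousAt
    exact ((continuousOn_polylogKernel hnorm hz1).mono Ioi_subset_Ici_self).locallyIntegrableOn
      measurableSet_Ioi
  have hGamma : ContinuousAt Complex.Gamma 1 :=
    (Complex.differentiableAt_Gamma _ fun m h ↦ by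
      have := congrArg re h
      simp only [one_re, neg_re, natCast_re] at this
      linarith [(Nat.cast_nonneg m : (0 : ℝ) ≤ m)]).continuousAt
  have h := eq_at_one_of_eq_on_one_lt_re
    (hGamma.mul (differentiable_expZeta_of_ne_zero ha0 1).continuousAt) hcont
    fun s hs ↦ Gamma_mul_expZeta a hs
  rw [Pi.mul_apply, Complex.Gamma_one, one_mul, mellin_polylogKernel_one hnorm hz1, hz, one_sub_exp_eq,
    Complex.log_ofReal_mul hsin (Complex.exp_ne_zero _), Complex.log_exp, neg_add'] at h
  · exact h
  · simp only [mul_im, ofReal_re, I_im, mul_one, ofReal_im, I_re, mul_zero, add_zero]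
    nlinarith [ha.1]
  · simp only [mul_im, ofReal_re, I_im, mul_one, ofReal_im, I_re, mul_zero, add_zero]
    nlinarith [ha.2]

lemma B₁_eq_fract (x : ℝ) : B₁ x = if Int.fract x = 0 then 0 else Int.fract x - 1 / 2 := rfl

lemma B₁_periodic : Function.Periodic B₁ 1 := fun x ↦ by
  rw [B₁_eq_fract, B₁_eq_fract, Int.fract_add_one]

/-- The first Bernoulli function `B₁`, as a function on the circle `ℝ / ℤ`. -/
noncomputable def circleB₁ : UnitAddCircle → ℝ := B₁_periodic.lift

lemma circleB₁_coe (x : ℝ) : circleB₁ (x : UnitAddCircle) = B₁ x := rfl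

lemma coe_fract (y : ℝ) : ((Int.fract y : ℝ) : UnitAddCircle) = y := by
  rw [← sub_eq_zero, ← AddCircle.coe_sub, AddCircle.coe_eq_zero_iff]
  exact ⟨-⌊y⌋, by rw [Int.fract]; simp⟩

/-- The Fourier expansion `∑ sin(2πnx)/n = -π B₁(x)`, with the conditionally convergent series
read as a value of the sine zeta function. -/
theorem sinZeta_one (x : UnitAddCircle) : sinZeta x 1 = -Real.pi * (circleB₁ x : ℂ) := by
  obtain ⟨y, rfl⟩ := QuotientAddGroup.mk_surjective x
  rw [circleB₁_coe, B₁_eq_fract]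
  split_ifs with h
  · have h0 := sinZeta_neg 0 1
    rw [neg_zero, self_eq_neg] at h0
    rw [← coe_fract, h, AddCircle.coe_zero, h0]
    simp
  · rw [← coe_fract]
    set a := Int.fract y
    have ha : a ∈ Ioo (0 : ℝ) 1 :=
      ⟨lt_of_le_of_ne (Int.fract_nonneg y) (Ne.symm h), Int.fract_lt_one y⟩
    have ha' : 1 - a ∈ Ioo (0 : ℝ) 1 := ⟨by linarith [ha.2], by linarith [ha.1]⟩
    have hneg : (-(a : UnitAddCircle)) = ((1 - a : ℝ) : UnitAddCircle) := by
      rw [AddCircle.coe_sub, AddCircle.coe_period, zero_sub]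
    rw [sinZeta_eq, hneg, expZeta_one ha, expZeta_one ha',
      show Real.pi * (1 - a) = Real.pi - Real.pi * a by ring, Real.sin_pi_sub]
    push_cast
    field_simp
    ring_nf

lemma circleB₁_neg (x : UnitAddCircle) : circleB₁ (-x) = -circleB₁ x := by
  have h := sinZeta_neg x 1
  rw [sinZeta_one, sinZeta_one, ← mul_neg] at h
  exact_mod_cast mul_left_cancel₀ (neg_ne_zero.mpr (ofReal_ne_zero.mpr Real.pi_ne_zero)) h

/-- The distribution relation of the first Bernoulli function. -/
theorem sum_circleB₁_add_toAddCircle (f : ℕ) [NeZero f] (y : UnitAddCircle) :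
    ∑ t : ZMod f, circleB₁ (y + ZMod.toAddCircle t) = circleB₁ (f • y) := by
  obtain ⟨y, rfl⟩ := QuotientAddGroup.mk_surjective y
  change ∑ t : ZMod f, circleB₁ ((y : UnitAddCircle) + ZMod.toAddCircle t) =
    circleB₁ (f • (y : UnitAddCircle))
  have hf : (0 : ℝ) < f := by exact_mod_cast NeZero.pos f
  -- Both sides are invariant under `y ↦ y + 1 / f`, so that `y` may be taken in `[0, 1 / f)`.
  set z : ℝ := Int.fract (f * y) / f with hz
  have hy : (y : UnitAddCircle) = z + ZMod.toAddCircle ((⌊f * y⌋ : ℤ) : ZMod f) := by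
    rw [ZMod.toAddCircle_intCast, ← AddCircle.coe_add, hz, ← add_div, Int.fract_add_floor,
      mul_div_cancel_left₀ _ hf.ne']
  have hfy : f • (y : UnitAddCircle) = (Int.fract (f * y) : ℝ) := by
    rw [coe_fract, ← AddCircle.coe_nsmul, nsmul_eq_mul]
  rw [hfy, hy]
  simp_rw [add_assoc, ← map_add]
  refine (Equiv.sum_comp (Equiv.addLeft ((⌊f * y⌋ : ℤ) : ZMod f))
    fun t ↦ circleB₁ ((z : UnitAddCircle) + ZMod.toAddCircle t)).trans ?_
  have h0 := Int.fract_nonneg (f * y)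
  have h1 := Int.fract_lt_one (f * y)
  set w := Int.fract (f * y)
  have hval (t : ZMod f) : circleB₁ ((z : UnitAddCircle) + ZMod.toAddCircle t) =
      (w / f + (t.val : ℝ) / f - 1 / 2) + if t = 0 then (if w = 0 then 1 / 2 else 0) else 0 := by
    have hlt : ((t.val : ℝ) + 1) ≤ f := by exact_mod_cast t.val_lt
    have hfr : Int.fract (z + (t.val : ℝ) / f) = z + t.val / f := by
      rw [Int.fract_eq_self, hz, ← add_div]
      exact ⟨by positivity, by rw [div_lt_one hf]; linarith⟩
    have hzero : z + (t.val : ℝ) / f = 0 ↔ t = 0 ∧ w = 0 := by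
      rw [hz, ← add_div, div_eq_zero_iff, or_iff_left hf.ne',
        add_eq_zero_iff_of_nonneg h0 (Nat.cast_nonneg _), Nat.cast_eq_zero, ZMod.val_eq_zero,
        and_comm]
    rw [ZMod.toAddCircle_apply, ← AddCircle.coe_add, circleB₁_coe, B₁_eq_fract, hfr, if_congr hzero rfl rfl,
      hz]
    by_cases ht : t = 0 <;> by_cases hw : w = 0 <;> simp [ht, hw]
  have hsum : ∑ t : ZMod f, (t.val : ℝ) = f * (f - 1) / 2 := by
    obtain ⟨m, rfl⟩ := Nat.exists_eq_succ_of_ne_zero (NeZero.ne f)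
    have h2 := Finset.sum_range_id_mul_two (m + 1)
    rw [Nat.add_sub_cancel] at h2
    have h3 : ∑ t : ZMod (m + 1), (t.val : ℝ) = ∑ i ∈ Finset.range (m + 1), (i : ℝ) :=
      Fin.sum_univ_eq_sum_range (fun i ↦ (i : ℝ)) (m + 1)
    rw [h3]
    have h4 : (∑ i ∈ Finset.range (m + 1), (i : ℝ)) * 2 = (m + 1) * m := by
      rw [← Nat.cast_sum]
      exact_mod_cast h2
    push_cast
    linarith
  have hww : Int.fract w = w := Int.fract_fract _
  simp_rw [hval, Finset.sum_add_distrib, Finset.sum_sub_distrib, Finset.sum_add_distrib]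
  rw [circleB₁_coe, B₁_eq_fract, hww, ← Finset.sum_div _ (fun t : ZMod f ↦ (t.val : ℝ)), hsum]
  simp only [Finset.sum_const, Finset.card_univ, ZMod.card, nsmul_eq_mul, Finset.sum_ite_eq',
    Finset.mem_univ, if_true]
  split_ifs with hw
  · rw [hw]; field_simp; ring
  · field_simp; ring

end DedekindSum

/-! ### Sums of `B₁` against primitive characters -/

namespace DedekindSum
open Complex HurwitzZeta DirichletCharacter

lemma sum_mul_stdAddChar_of_isPrimitive {q : ℕ} [NeZero q] {χ : DirichletCharacter ℂ q}
    (hχ : χ.IsPrimitive) (m : ℕ) :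
    ∑ r : ZMod q, χ r * cexp (2 * Real.pi * I * ((r.val / q : ℝ) : ℂ) * m) = χ⁻¹ m * tau χ := by
  rw [tau, ← gaussSum_mulShift_of_isPrimitive _ hχ]
  refine Finset.sum_congr rfl fun r _ ↦ ?_
  have h : ((m : ZMod q) * r) = (((m : ℤ) * r.val : ℤ) : ZMod q) := by simp
  rw [AddChar.mulShift_apply, h, ZMod.stdAddChar_coe]
  congr 2
  push_cast
  ring

lemma isPrimitive_inv {q : ℕ} {χ : DirichletCharacter ℂ q} (hχ : χ.IsPrimitive) :
    χ⁻¹.IsPrimitive := by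
  rw [isPrimitive_def, conductor_inv]
  exact hχ

/-- For `1 < re s`, a sum of exponential zeta functions twisted by two primitive characters is an
`L`-series: apply the Gauss sum identity to each coefficient. -/
lemma sum_char_mul_expZeta {q₁ q N : ℕ} [NeZero q₁] [NeZero q] [NeZero N]
    {χ : DirichletCharacter ℂ q₁} {ψ : DirichletCharacter ℂ q} (hχ : χ.IsPrimitive)
    (hψ : ψ.IsPrimitive) {Ξ : DirichletCharacter ℂ N} (hΞ : ∀ n : ℕ, Ξ n = χ n * ψ⁻¹ n)
    {s : ℂ} (hs : 1 < s.re) :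
    ∑ n : ZMod q₁, ∑ r : ZMod q, χ⁻¹ n * ψ r *
        expZeta (ZMod.toAddCircle n + ZMod.toAddCircle r) s =
      tau χ⁻¹ * tau ψ * Ξ.LFunction s := by
  have h1 : HasSum (fun m : ℕ ↦ ∑ n : ZMod q₁, ∑ r : ZMod q, χ⁻¹ n * ψ r *
      (cexp (2 * Real.pi * I * ((n.val / q₁ + r.val / q : ℝ) : ℂ) * m) / (m : ℂ) ^ s))
      (∑ n : ZMod q₁, ∑ r : ZMod q, χ⁻¹ n * ψ r *
        expZeta (ZMod.toAddCircle n + ZMod.toAddCircle r) s) := by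
    refine hasSum_sum fun n _ ↦ hasSum_sum fun r _ ↦ HasSum.mul_left _ ?_
    rw [ZMod.toAddCircle_apply, ZMod.toAddCircle_apply, ← AddCircle.coe_add]
    exact hasSum_expZeta_of_one_lt_re _ hs
  have h2 : HasSum (fun m : ℕ ↦ tau χ⁻¹ * tau ψ * (Ξ m / (m : ℂ) ^ s))
      (tau χ⁻¹ * tau ψ * Ξ.LFunction s) := by
    refine HasSum.mul_left _ ?_
    rw [LFunction_eq_LSeries _ hs]
    exact (ZMod.LSeriesSummable_of_one_lt_re (fun x ↦ Ξ x) hs).hasSum.congr_fun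
      fun m ↦ (LSeries.term_of_ne_zero' (ne_zero_of_one_lt_re hs) (fun n : ℕ ↦ Ξ n) m).symm
  refine h1.unique (h2.congr_fun fun m ↦ ?_)
  have h3 := sum_mul_stdAddChar_of_isPrimitive (isPrimitive_inv hχ) m
  have h4 := sum_mul_stdAddChar_of_isPrimitive hψ m
  rw [inv_inv] at h3
  rw [hΞ, show tau χ⁻¹ * tau ψ * (χ m * ψ⁻¹ m / (m : ℂ) ^ s) =
    (χ m * tau χ⁻¹) * (ψ⁻¹ m * tau ψ) * ((m : ℂ) ^ s)⁻¹ by ring, ← h3, ← h4,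
    Finset.sum_mul_sum, Finset.sum_mul]
  refine Finset.sum_congr rfl fun n _ ↦ ?_
  rw [Finset.sum_mul]
  refine Finset.sum_congr rfl fun r _ ↦ ?_
  rw [ofReal_add, mul_add, add_mul, Complex.exp_add]
  ring

lemma sum_sum_eq_zero_of_odd {A B : Type*} [AddGroup A] [Fintype A] [AddGroup B] [Fintype B]
    (F : A → B → ℂ) (hF : ∀ a b, F (-a) (-b) = -F a b) : ∑ a, ∑ b, F a b = 0 := by
  rw [← self_eq_neg]
  calc ∑ a, ∑ b, F a b = ∑ a, ∑ b, F (-a) (-b) := by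
        rw [← Equiv.sum_comp (Equiv.neg A)]
        exact Finset.sum_congr rfl fun a _ ↦ (Equiv.sum_comp (Equiv.neg B) _).symm
    _ = -∑ a, ∑ b, F a b := by simp_rw [hF, Finset.sum_neg_distrib]

lemma map_neg_eq {q : ℕ} (χ : DirichletCharacter ℂ q) (x : ZMod q) : χ (-x) = χ (-1) * χ x := by
  rw [← map_mul, neg_one_mul]

lemma inv_apply_neg_one {q : ℕ} (χ : DirichletCharacter ℂ q) : χ⁻¹ (-1) = χ (-1) := by
  rw [MulChar.inv_apply, ← Units.val_one, ← Units.val_neg, Ring.inverse_unit, inv_neg, inv_one]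

/-- The formula for `L(1, ·)` at an odd character by a generalized Bernoulli number, for a product
`χ ψ⁻¹` of two primitive characters. The character `Ξ` stands for this product; only its values on
`ℕ` matter, so it may be given at any level. -/
theorem sum_char_mul_circleB₁ {q₁ q N : ℕ} [NeZero q₁] [NeZero q] [NeZero N]
    {χ : DirichletCharacter ℂ q₁} {ψ : DirichletCharacter ℂ q} (hχ : χ.IsPrimitive)
    (hψ : ψ.IsPrimitive) {Ξ : DirichletCharacter ℂ N} (hΞ : ∀ n : ℕ, Ξ n = χ n * ψ⁻¹ n)
    (hodd : ψ (-1) * χ (-1) = -1) :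
    Real.pi * ∑ n : ZMod q₁, ∑ r : ZMod q, χ⁻¹ n * ψ r *
        (circleB₁ (ZMod.toAddCircle n + ZMod.toAddCircle r) : ℂ) =
      I * (tau χ⁻¹ * tau ψ * Ξ.LFunction 1) := by
  have hΞ1 : Ξ ≠ 1 := by
    rintro rfl
    -- a natural number that is `-1` modulo both `q₁` and `q`
    have h := hΞ (q₁ * q - 1)
    have hpos : 1 ≤ q₁ * q := Nat.one_le_iff_ne_zero.mpr (mul_ne_zero (NeZero.ne _) (NeZero.ne _))
    have h1 : ((q₁ * q - 1 : ℕ) : ZMod q₁) = -1 := by rw [Nat.cast_sub hpos]; simp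
    have h2 : ((q₁ * q - 1 : ℕ) : ZMod q) = -1 := by rw [Nat.cast_sub hpos]; simp
    rw [h1, h2, inv_apply_neg_one, mul_comm (χ _), hodd] at h
    by_cases hu : IsUnit ((q₁ * q - 1 : ℕ) : ZMod N)
    · rw [MulChar.one_apply hu] at h
      norm_num at h
    · rw [MulChar.map_nonunit _ hu] at h
      norm_num at h
  have hsign (n : ZMod q₁) (r : ZMod q) : χ⁻¹ (-n) * ψ (-r) = -(χ⁻¹ n * ψ r) := by
    rw [map_neg_eq χ⁻¹, map_neg_eq ψ, inv_apply_neg_one]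
    linear_combination χ⁻¹ n * ψ r * hodd
  have key (s : ℂ) (hs : 1 < s.re) : I * ∑ n : ZMod q₁, ∑ r : ZMod q, χ⁻¹ n * ψ r *
      sinZeta (ZMod.toAddCircle n + ZMod.toAddCircle r) s =
      tau χ⁻¹ * tau ψ * Ξ.LFunction s := by
    have h0 : ∑ n : ZMod q₁, ∑ r : ZMod q, χ⁻¹ n * ψ r *
        cosZeta (ZMod.toAddCircle n + ZMod.toAddCircle r) s = 0 := by
      refine sum_sum_eq_zero_of_odd _ fun n r ↦ ?_
      rw [map_neg ZMod.toAddCircle n, map_neg ZMod.toAddCircle r, ← neg_add, cosZeta_neg, hsign, neg_mul]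
    rw [← sum_char_mul_expZeta hχ hψ hΞ hs]
    simp only [expZeta, mul_add, Finset.sum_add_distrib, h0, zero_add, Finset.mul_sum]
    exact Finset.sum_congr rfl fun n _ ↦ Finset.sum_congr rfl fun r _ ↦ by ring
  have h := eq_at_one_of_eq_on_one_lt_re
    (f := fun s ↦ I * ∑ n : ZMod q₁, ∑ r : ZMod q, χ⁻¹ n * ψ r *
      sinZeta (ZMod.toAddCircle n + ZMod.toAddCircle r) s)
    (g := fun s ↦ tau χ⁻¹ * tau ψ * Ξ.LFunction s) ?_ ?_ key
  · simp only [sinZeta_one] at h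
    rw [← h, ← mul_assoc, I_mul_I, Finset.mul_sum, Finset.mul_sum]
    refine Finset.sum_congr rfl fun n _ ↦ ?_
    rw [Finset.mul_sum, Finset.mul_sum]
    exact Finset.sum_congr rfl fun r _ ↦ by ring
  · refine continuousAt_const.mul (tendsto_finsetSum _ fun n _ ↦ tendsto_finsetSum _ fun r _ ↦ ?_)
    exact continuousAt_const.mul (differentiableAt_sinZeta _ 1).continuousAt
  · exact continuousAt_const.mul (differentiable_LFunction hΞ1 1).continuousAt

end DedekindSum

/-! ### Sums of `B₁` against imprimitive characters -/

namespace DedekindSum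
open DirichletCharacter

/-- For a unit `f` this is a change of variables. Primitivity makes it true for all `f`: if `f` is
not a unit, then both sides vanish. -/
lemma sum_isPrimitive_mul_comp_mul {q : ℕ} [NeZero q] {χ : DirichletCharacter ℂ q}
    (hχ : χ.IsPrimitive) (h : ZMod q → ℂ) (f : ZMod q) :
    ∑ n, χ n * h (f * n) = χ⁻¹ f * ∑ n, χ n * h n := by
  -- By Fourier inversion it suffices to consider additive characters `h`.
  have hexp (n : ZMod q) : h n = ∑ j : ZMod q,
      ((q : ℂ)⁻¹ * ZMod.dft h j) * ZMod.stdAddChar (j * n) := by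
    conv_lhs => rw [← ZMod.dft.symm_apply_apply h, ZMod.invDFT_apply]
    rw [smul_eq_mul, Finset.mul_sum]
    exact Finset.sum_congr rfl fun j _ ↦ by rw [smul_eq_mul]; ring
  have hgauss (j f : ZMod q) : ∑ n, χ n * ZMod.stdAddChar (j * (f * n)) =
      χ⁻¹ f * (χ⁻¹ j * tau χ) := by
    have := gaussSum_mulShift_of_isPrimitive ZMod.stdAddChar hχ (j * f)
    rw [tau, ← mul_assoc, mul_comm (χ⁻¹ f), ← map_mul, ← this, gaussSum]
    simp only [AddChar.mulShift_apply, mul_assoc]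
  have hsum (f : ZMod q) : ∑ n, χ n * h (f * n) =
      χ⁻¹ f * ∑ j : ZMod q, ((q : ℂ)⁻¹ * ZMod.dft h j) * (χ⁻¹ j * tau χ) := by
    simp_rw [hexp (f * _), Finset.mul_sum]
    rw [Finset.sum_comm]
    refine Finset.sum_congr rfl fun j _ ↦ ?_
    rw [mul_left_comm, ← hgauss, Finset.mul_sum]
    exact Finset.sum_congr rfl fun n _ ↦ by ring
  have h1 := hsum 1
  simp only [one_mul, map_one] at h1
  rw [hsum, h1]

lemma sum_range_eq_sum_zmod {M : Type*} [AddCommMonoid M] (N : ℕ) [NeZero N] (F : ℕ → M) :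
    ∑ k ∈ Finset.range N, F k = ∑ k : ZMod N, F k.val := by
  obtain ⟨m, rfl⟩ := Nat.exists_eq_succ_of_ne_zero (NeZero.ne N)
  exact (Fin.sum_univ_eq_sum_range F (m + 1)).symm

/-- Summing over the residues modulo `q * f` in a fixed class modulo `q` by the distribution
relation. -/
lemma sum_range_mul_char_circleB₁ {q f : ℕ} [NeZero q] [NeZero f] (ψ : DirichletCharacter ℂ q)
    (x : UnitAddCircle) :
    ∑ k ∈ Finset.range (f * q), ψ k * (circleB₁ (x + ((k / (f * q : ℕ) : ℝ) : UnitAddCircle)) : ℂ) =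
      ∑ r : ZMod q, ψ r * (circleB₁ (f • x + ZMod.toAddCircle r) : ℂ) := by
  have hf : (f : ℝ) ≠ 0 := by exact_mod_cast NeZero.ne f
  have hq : (q : ℝ) ≠ 0 := by exact_mod_cast NeZero.ne q
  have hinner (r : ℕ) : ∑ t ∈ Finset.range f,
      circleB₁ (x + (((r + q * t : ℕ) / (f * q : ℕ) : ℝ) : UnitAddCircle)) =
      circleB₁ (f • x + ((r / q : ℝ) : UnitAddCircle)) := by
    have h := sum_circleB₁_add_toAddCircle f (x + ((r / (f * q : ℕ) : ℝ) : UnitAddCircle))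
    rw [smul_add, ← AddCircle.coe_nsmul, nsmul_eq_mul,
      show (f : ℝ) * (r / (f * q : ℕ)) = r / q by push_cast; field_simp] at h
    rw [← h, sum_range_eq_sum_zmod]
    refine Finset.sum_congr rfl fun t _ ↦ ?_
    rw [ZMod.toAddCircle_apply, add_assoc, ← AddCircle.coe_add]
    congr 3
    push_cast
    field_simp
  rw [Finset.sum_range, ← Equiv.sum_comp finProdFinEquiv, Fintype.sum_prod_type, Finset.sum_comm]
  have hr := sum_range_eq_sum_zmod q
    fun r ↦ ψ (r : ZMod q) * (circleB₁ (f • x + ((r / q : ℝ) : UnitAddCircle)) : ℂ)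
  simp only [ZMod.natCast_zmod_val, ← ZMod.toAddCircle_apply] at hr
  rw [← hr, Finset.sum_range]
  refine Finset.sum_congr rfl fun r _ ↦ ?_
  rw [← hinner, Complex.ofReal_sum, Finset.mul_sum, Finset.sum_range]
  refine Finset.sum_congr rfl fun t _ ↦ ?_
  simp [finProdFinEquiv]

/-- Möbius inversion of the condition that `b` be coprime to `d`. -/
lemma sum_filter_coprime_eq_sum_moebius {d : ℕ} (hd : d ≠ 0) (F : ℕ → ℂ) :
    ∑ b ∈ Finset.range d with b.Coprime d, F b =
      ∑ e ∈ d.divisors, (μ e : ℂ) * ∑ k ∈ Finset.range (d / e), F (e * k) := by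
  have hmu (b : ℕ) : (∑ e ∈ (b.gcd d).divisors, (μ e : ℂ)) = if b.Coprime d then 1 else 0 := by
    have h := congrArg (fun f : ArithmeticFunction ℤ ↦ f (b.gcd d))
      ArithmeticFunction.moebius_mul_coe_zeta
    simp only [ArithmeticFunction.coe_mul_zeta_apply,
      ArithmeticFunction.one_apply] at h
    exact_mod_cast h
  have hdiv (b : ℕ) : (b.gcd d).divisors = d.divisors.filter (· ∣ b) := by
    ext e
    simp [Nat.dvd_gcd_iff, hd, and_comm]
  rw [Finset.sum_filter]
  calc ∑ b ∈ Finset.range d, (if b.Coprime d then F b else 0)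
      = ∑ b ∈ Finset.range d, ∑ e ∈ d.divisors, if e ∣ b then (μ e : ℂ) * F b else 0 := by
        refine Finset.sum_congr rfl fun b _ ↦ ?_
        rw [← Finset.sum_filter, ← hdiv, ← Finset.sum_mul, hmu]
        simp
    _ = ∑ e ∈ d.divisors, ∑ b ∈ Finset.range d with e ∣ b, (μ e : ℂ) * F b := by
        rw [Finset.sum_comm]
        simp_rw [Finset.sum_filter]
    _ = _ := by
        refine Finset.sum_congr rfl fun e he ↦ ?_
        obtain ⟨m, rfl⟩ := Nat.dvd_of_mem_divisors he
        have he0 : 0 < e := Nat.pos_of_ne_zero fun h ↦ hd (by simp [h])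
        rw [Finset.mul_sum, Nat.mul_div_cancel_left _ he0]
        refine (Finset.sum_nbij (e * ·) ?_ ?_ ?_ ?_).symm
        · intro k hk
          simp only [Finset.mem_range, Finset.mem_filter] at hk ⊢
          exact ⟨Nat.mul_lt_mul_of_pos_left hk he0, dvd_mul_right e k⟩
        · intro a _ b _ h
          exact Nat.eq_of_mul_eq_mul_left he0 h
        · rintro b hb
          simp only [Finset.coe_filter, Finset.mem_range, Set.mem_ofPred_eq] at hb
          obtain ⟨h1, k, rfl⟩ := hb
          exact ⟨k, by simpa using Nat.lt_of_mul_lt_mul_left h1, rfl⟩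
        · intro k _
          rfl

lemma changeLevel_natCast_of_coprime {q d : ℕ} (h : q ∣ d) (ψ : DirichletCharacter ℂ q) {b : ℕ}
    (hb : b.Coprime d) : changeLevel h ψ (b : ZMod d) = ψ b := by
  have := changeLevel_eq_cast_of_dvd' ψ h (a := (b : ℤ)) (Nat.isCoprime_iff_coprime.mpr hb)
  simpa using this

lemma eq_zero_of_not_coprime {d : ℕ} (χ : DirichletCharacter ℂ d) {b : ℕ} (hb : ¬ b.Coprime d) :
    χ (b : ZMod d) = 0 :=
  χ.map_nonunit fun h ↦ hb ((ZMod.isUnit_iff_coprime b d).mp h)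

/-- Sums of `B₁` against an imprimitive character, in terms of the character inducing it. -/
lemma sum_changeLevel_mul_circleB₁ {q d : ℕ} [NeZero q] [NeZero d] (h : q ∣ d)
    (ψ : DirichletCharacter ℂ q) (x : UnitAddCircle) :
    ∑ b : ZMod d, changeLevel h ψ b * (circleB₁ (x + ZMod.toAddCircle b) : ℂ) =
      ∑ e ∈ (d / q).divisors, (μ e : ℂ) * ψ e *
        ∑ r : ZMod q, ψ r * (circleB₁ ((d / q / e) • x + ZMod.toAddCircle r) : ℂ) := by
  obtain ⟨D, rfl⟩ := h
  have hq0 : 0 < q := NeZero.pos q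
  have hD0 : D ≠ 0 := fun h ↦ NeZero.ne (q * D) (by simp [h])
  rw [Nat.mul_div_cancel_left _ hq0]
  have h1 := sum_range_eq_sum_zmod (q * D) fun b ↦ changeLevel (dvd_mul_right q D) ψ (b : ZMod _) *
    (circleB₁ (x + ((b / (q * D : ℕ) : ℝ) : UnitAddCircle)) : ℂ)
  simp only [ZMod.natCast_zmod_val, ← ZMod.toAddCircle_apply] at h1
  have h2 : ∑ b ∈ Finset.range (q * D), changeLevel (dvd_mul_right q D) ψ (b : ZMod _) *
      (circleB₁ (x + ((b / (q * D : ℕ) : ℝ) : UnitAddCircle)) : ℂ) =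
      ∑ b ∈ Finset.range (q * D) with b.Coprime (q * D), ψ (b : ZMod q) *
      (circleB₁ (x + ((b / (q * D : ℕ) : ℝ) : UnitAddCircle)) : ℂ) := by
    rw [Finset.sum_filter]
    refine Finset.sum_congr rfl fun b _ ↦ ?_
    split_ifs with hb
    · rw [changeLevel_natCast_of_coprime _ _ hb]
    · rw [eq_zero_of_not_coprime _ hb, zero_mul]
  rw [← h1, h2, sum_filter_coprime_eq_sum_moebius (NeZero.ne _)]
  -- Only the divisors prime to `q` contribute, and these divide `D`.
  have hsub : D.divisors ⊆ (q * D).divisors :=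
    Nat.divisors_subset_of_dvd (NeZero.ne _) (dvd_mul_left D q)
  rw [← Finset.sum_subset hsub]
  · refine Finset.sum_congr rfl fun e he ↦ ?_
    obtain ⟨f, rfl⟩ := Nat.dvd_of_mem_divisors he
    have he0 : 0 < e := Nat.pos_of_ne_zero fun h ↦ hD0 (by simp [h])
    have : NeZero f := ⟨fun h ↦ hD0 (by simp [h])⟩
    have hdiv : q * (e * f) / e = f * q := by
      rw [show q * (e * f) = e * (f * q) by ring, Nat.mul_div_cancel_left _ he0]
    rw [Nat.mul_div_cancel_left _ he0, hdiv, ← sum_range_mul_char_circleB₁, mul_assoc,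
      Finset.mul_sum _ _ (ψ e)]
    congr 1
    refine Finset.sum_congr rfl fun k _ ↦ ?_
    have : ((e * k : ℕ) : ℝ) / (q * (e * f) : ℕ) = k / (f * q : ℕ) := by
      push_cast
      field_simp
    rw [this, Nat.cast_mul, map_mul, mul_assoc]
  · intro e he heD
    have hcop : ¬ e.Coprime q := fun hc ↦
      heD (Nat.mem_divisors.mpr ⟨hc.dvd_of_dvd_mul_left (Nat.dvd_of_mem_divisors he), hD0⟩)
    simp [eq_zero_of_not_coprime ψ hcop]

/-- The sum against the imprimitive character induced by `ψ`, twisted by a primitive character `χ`,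
is the finite factor `(χ ∗ μψ)(d / q)` times the sum against `ψ` itself. -/
theorem sum_changeLevel_mul_sum_circleB₁ {q₁ q d : ℕ} [NeZero q₁] [NeZero q] [NeZero d] (h : q ∣ d)
    {χ : DirichletCharacter ℂ q₁} (hχ : χ.IsPrimitive) (ψ : DirichletCharacter ℂ q) :
    ∑ b : ZMod d, changeLevel h ψ b * ∑ n : ZMod q₁, χ⁻¹ n *
        (circleB₁ (ZMod.toAddCircle n + ZMod.toAddCircle b) : ℂ) =
      LSeries.convolution (fun n : ℕ ↦ χ (n : ZMod q₁))
        (fun n : ℕ ↦ ((μ n : ℤ) : ℂ) * ψ (n : ZMod q)) (d / q) *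
      ∑ n : ZMod q₁, ∑ r : ZMod q, χ⁻¹ n * ψ r *
        (circleB₁ (ZMod.toAddCircle n + ZMod.toAddCircle r) : ℂ) := by
  have hinner (f : ℕ) : ∑ n : ZMod q₁, χ⁻¹ n * ∑ r : ZMod q, ψ r *
      (circleB₁ (f • ZMod.toAddCircle n + ZMod.toAddCircle r) : ℂ) =
      χ f * ∑ n : ZMod q₁, ∑ r : ZMod q, χ⁻¹ n * ψ r *
        (circleB₁ (ZMod.toAddCircle n + ZMod.toAddCircle r) : ℂ) := by
    have := sum_isPrimitive_mul_comp_mul (isPrimitive_inv hχ) (fun n ↦ ∑ r : ZMod q, ψ r *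
      (circleB₁ (ZMod.toAddCircle n + ZMod.toAddCircle r) : ℂ)) f
    simp only [← nsmul_eq_mul, map_nsmul, inv_inv] at this
    rw [this]
    simp only [Finset.mul_sum, mul_assoc]
  calc _ = ∑ n : ZMod q₁, χ⁻¹ n * ∑ b : ZMod d, changeLevel h ψ b *
        (circleB₁ (ZMod.toAddCircle n + ZMod.toAddCircle b) : ℂ) := by
        simp only [Finset.mul_sum]
        rw [Finset.sum_comm]
        exact Finset.sum_congr rfl fun n _ ↦ Finset.sum_congr rfl fun b _ ↦ by ring
    _ = ∑ e ∈ (d / q).divisors, (μ e : ℂ) * ψ e * (χ (d / q / e : ℕ) *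
          ∑ n : ZMod q₁, ∑ r : ZMod q, χ⁻¹ n * ψ r *
            (circleB₁ (ZMod.toAddCircle n + ZMod.toAddCircle r) : ℂ)) := by
        simp only [sum_changeLevel_mul_circleB₁, Finset.mul_sum (s := Nat.divisors _)]
        rw [Finset.sum_comm]
        refine Finset.sum_congr rfl fun e _ ↦ ?_
        rw [← hinner, Finset.mul_sum]
        exact Finset.sum_congr rfl fun n _ ↦ by ring
    _ = _ := by
        rw [LSeries.convolution_def]
        simp only
        rw [Nat.sum_divisorsAntidiagonal' (f := fun a b ↦ χ (a : ZMod q₁) *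
          (((μ b : ℤ) : ℂ) * ψ (b : ZMod q))), Finset.sum_mul]
        exact Finset.sum_congr rfl fun e _ ↦ by ring

end DedekindSum

/-! ### Evaluation by `L`-values, and averages over units -/

namespace DedekindSum
open Complex DirichletCharacter

/-- Sums of `B₁` against an odd imprimitive character and a second primitive character, in terms
of a Gauss sum and an `L`-value. -/
theorem pi_mul_sum_changeLevel_mul_sum_circleB₁ {q₁ q d N : ℕ} [NeZero q₁] [NeZero q] [NeZero d]
    [NeZero N] (h : q ∣ d) {χ : DirichletCharacter ℂ q₁} {ψ : DirichletCharacter ℂ q}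
    (hχ : χ.IsPrimitive) (hψ : ψ.IsPrimitive) {Ξ : DirichletCharacter ℂ N}
    (hΞ : ∀ n : ℕ, Ξ n = χ n * ψ⁻¹ n) (hodd : ψ (-1) * χ (-1) = -1) :
    Real.pi * ∑ b : ZMod d, changeLevel h ψ b * ∑ n : ZMod q₁, χ⁻¹ n *
        (circleB₁ (ZMod.toAddCircle n + ZMod.toAddCircle b) : ℂ) =
      I * (tau ψ * tau χ⁻¹ * LSeries.convolution (fun n : ℕ ↦ χ (n : ZMod q₁))
        (fun n : ℕ ↦ ((μ n : ℤ) : ℂ) * ψ (n : ZMod q)) (d / q) * Ξ.LFunction 1) := by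
  rw [sum_changeLevel_mul_sum_circleB₁ h hχ]
  linear_combination LSeries.convolution (fun n : ℕ ↦ χ (n : ZMod q₁))
    (fun n : ℕ ↦ ((μ n : ℤ) : ℂ) * ψ (n : ZMod q)) (d / q) * sum_char_mul_circleB₁ hχ hψ hΞ hodd

/-- Both sides are `∑ μ(e) θ(e)`, over the divisors of `d / q` and of `d`; the additional divisors
of `d` are not coprime to `q`. -/
lemma convolution_one_moebius_div {q d : ℕ} [NeZero d] (h : q ∣ d)
    (θ : DirichletCharacter ℂ q) :
    LSeries.convolution (fun n : ℕ ↦ (1 : DirichletCharacter ℂ 1) (n : ZMod 1))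
      (fun n : ℕ ↦ ((μ n : ℤ) : ℂ) * θ (n : ZMod q)) (d / q) =
    LSeries.convolution (fun n : ℕ ↦ θ (n : ZMod q) * ((μ n : ℤ) : ℂ)) (fun _ ↦ 1) d := by
  have hone (n : ℕ) : (1 : DirichletCharacter ℂ 1) (n : ZMod 1) = 1 :=
    MulChar.one_apply (isUnit_of_subsingleton _)
  rw [LSeries.convolution_def, LSeries.convolution_def]
  simp only [hone, one_mul, mul_one]
  rw [Nat.sum_divisorsAntidiagonal' (f := fun _ b ↦ ((μ b : ℤ) : ℂ) * θ (b : ZMod q)),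
    Nat.sum_divisorsAntidiagonal (f := fun a _ ↦ θ (a : ZMod q) * ((μ a : ℤ) : ℂ))]
  obtain ⟨D, rfl⟩ := h
  have hqD := NeZero.ne (q * D)
  have hq0 : 0 < q := Nat.pos_of_ne_zero fun h ↦ hqD (by simp [h])
  have hD0 : D ≠ 0 := fun h ↦ hqD (by simp [h])
  rw [Nat.mul_div_cancel_left _ hq0]
  refine (Finset.sum_subset (Nat.divisors_subset_of_dvd hqD (dvd_mul_left D q))
    fun e he heD ↦ ?_).trans (Finset.sum_congr rfl fun e _ ↦ mul_comm _ _)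
  have hcop : ¬ e.Coprime q := fun hc ↦
    heD (Nat.mem_divisors.mpr ⟨hc.dvd_of_dvd_mul_left (Nat.dvd_of_mem_divisors he), hD0⟩)
  simp [eq_zero_of_not_coprime θ hcop]

/-- The generalized Bernoulli number of an odd imprimitive character, in terms of a Gauss sum and
an `L`-value. -/
theorem pi_mul_sum_changeLevel_mul_circleB₁ {q d N : ℕ} [NeZero q] [NeZero d] [NeZero N]
    (h : q ∣ d) {θ : DirichletCharacter ℂ q} (hθ : θ.IsPrimitive) {Ξ : DirichletCharacter ℂ N}
    (hΞ : ∀ n : ℕ, Ξ n = θ⁻¹ n) (hodd : θ (-1) = -1) :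
    Real.pi * ∑ k : ZMod d, changeLevel h θ k * (circleB₁ (ZMod.toAddCircle k) : ℂ) =
      I * (tau θ * LSeries.convolution (fun n : ℕ ↦ θ (n : ZMod q) * ((μ n : ℤ) : ℂ))
        (fun _ ↦ 1) d * Ξ.LFunction 1) := by
  have hone (x : ZMod 1) : (1 : DirichletCharacter ℂ 1) x = 1 :=
    MulChar.one_apply (isUnit_of_subsingleton _)
  have htau : tau (1 : DirichletCharacter ℂ 1) = 1 := by
    rw [tau, gaussSum, Fintype.sum_subsingleton _ (0 : ZMod 1), hone,
      AddChar.map_zero_eq_one, one_mul]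
  have key := pi_mul_sum_changeLevel_mul_sum_circleB₁ h (isPrimitive_one_level_one (R := ℂ)) hθ
    (Ξ := Ξ) (fun n ↦ by rw [hone, one_mul, hΞ]) (by rw [hone, mul_one, hodd])
  rw [convolution_one_moebius_div h, inv_one, htau, mul_one] at key
  rw [← key]
  congr 1
  refine Finset.sum_congr rfl fun k _ ↦ ?_
  rw [Fintype.sum_subsingleton _ (0 : ZMod 1), hone, map_zero, zero_add, one_mul]

lemma mul_natCast {m n : ℕ} (χ : DirichletCharacter ℂ m) (ψ : DirichletCharacter ℂ n) (k : ℕ) :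
    χ.mul ψ (k : ZMod _) = χ k * ψ k := by
  by_cases hk : k.Coprime (m.lcm n)
  · rw [DirichletCharacter.mul, MulChar.mul_apply, changeLevel_natCast_of_coprime _ _ hk,
      changeLevel_natCast_of_coprime _ _ hk]
  · rw [eq_zero_of_not_coprime _ hk, eq_comm, mul_eq_zero]
    by_contra! h
    have h1 : k.Coprime m := by_contra fun h' ↦ h.1 (eq_zero_of_not_coprime χ h')
    have h2 : k.Coprime n := by_contra fun h' ↦ h.2 (eq_zero_of_not_coprime ψ h')
    exact hk ((h1.mul_right h2).coprime_dvd_right (Nat.lcm_dvd_mul m n))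

lemma primitiveCharacter_inv_natCast {n : ℕ} [NeZero n] (χ : DirichletCharacter ℂ n) (k : ℕ) :
    χ⁻¹.primitiveCharacter (k : ZMod _) = χ.primitiveCharacter⁻¹ k := by
  have heq : changeLevel (dvd_of_eq (conductor_inv χ)) χ⁻¹.primitiveCharacter =
      χ.primitiveCharacter⁻¹ := by
    apply changeLevel_injective χ.conductor_dvd_level
    rw [← changeLevel_trans, changeLevel_primitiveCharacter, map_inv,
      changeLevel_primitiveCharacter]
  by_cases hk : k.Coprime χ.conductor
  · rw [← heq, changeLevel_natCast_of_coprime _ _ hk]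
  · rw [eq_zero_of_not_coprime _ hk, eq_zero_of_not_coprime]
    rwa [conductor_inv]

lemma changeLevel_neg_one {m n : ℕ} (h : m ∣ n) (χ : DirichletCharacter ℂ m) :
    changeLevel h χ (-1) = χ (-1) := by
  have := changeLevel_eq_cast_of_dvd' χ h (a := -1) (isCoprime_one_left.neg_left)
  simpa using this

lemma primitiveCharacter_neg_one {n : ℕ} (χ : DirichletCharacter ℂ n) :
    χ.primitiveCharacter (-1) = χ (-1) := by
  rw [← changeLevel_neg_one χ.conductor_dvd_level, changeLevel_primitiveCharacter]

/-- The character inducing `(ψ χ)⁻¹` has level dividing every common multiple of the conductor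
of `ψ` and the level of `χ`, and can be computed there. -/
lemma exists_changeLevel_primitiveCharacter_mul_inv {c q d : ℕ} [NeZero c] [NeZero q]
    (ψ : DirichletCharacter ℂ c) (χ : DirichletCharacter ℂ q) (hdc : d ∣ c)
    (hψ : ψ.conductor ∣ d) (hq : q ∣ d) :
    ∃ h : (ψ.mul χ)⁻¹.conductor ∣ d, changeLevel h (ψ.mul χ)⁻¹.primitiveCharacter =
      (changeLevel hψ ψ.primitiveCharacter)⁻¹ * (changeLevel hq χ)⁻¹ := by
  have hd : d ∣ c.lcm q := hdc.trans (Nat.dvd_lcm_left c q)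
  have h1 : changeLevel hd ((changeLevel hψ ψ.primitiveCharacter)⁻¹ * (changeLevel hq χ)⁻¹) =
      (ψ.mul χ)⁻¹ := by
    rw [DirichletCharacter.mul, mul_inv, map_mul, map_inv, map_inv, ← changeLevel_trans,
      ← changeLevel_trans,
      changeLevel_trans ψ.primitiveCharacter ψ.conductor_dvd_level (Nat.dvd_lcm_left c q),
      changeLevel_primitiveCharacter]
  have h2 : (ψ.mul χ)⁻¹.conductor ∣ d := conductor_dvd_of_mem_conductorSet _ ⟨hd, _, h1.symm⟩
  refine ⟨h2, changeLevel_injective hd ?_⟩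
  rw [h1, ← changeLevel_trans, changeLevel_primitiveCharacter]

/-- All fibres of a surjective homomorphism of finite groups have the same size. -/
lemma sum_comp_surjective {G H : Type*} [Group G] [Fintype G] [Group H] [Fintype H] {f : G →* H}
    (hf : Function.Surjective f) (F : H → ℂ) :
    ∑ g, F (f g) = (Fintype.card G : ℂ) / Fintype.card H * ∑ h, F h := by
  classical
  have hcard (h : H) : (Finset.univ.filter fun g ↦ f g = h).card =
      (Finset.univ.filter fun g ↦ f g = 1).card :=
    MonoidHom.card_fiber_eq_of_mem_range f (hf h) (hf 1)
  have hsum (F : H → ℂ) : ∑ g, F (f g) =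
      (Finset.univ.filter fun g ↦ f g = 1).card * ∑ h, F h := by
    rw [Finset.sum_comp F f, Finset.image_univ_of_surjective hf, Finset.mul_sum]
    exact Finset.sum_congr rfl fun h _ ↦ by rw [hcard, nsmul_eq_mul]
  have h1 := hsum fun _ ↦ 1
  simp only [Finset.sum_const, Finset.card_univ, nsmul_eq_mul, mul_one] at h1
  have hH : (Fintype.card H : ℂ) ≠ 0 := by exact_mod_cast Fintype.card_ne_zero
  rw [hsum, h1, mul_div_cancel_right₀ _ hH]

lemma sum_units_char_mul {d : ℕ} [NeZero d] (χ : DirichletCharacter ℂ d) (G : ZMod d → ℂ) :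
    ∑ u : (ZMod d)ˣ, χ u * G u = ∑ b : ZMod d, χ b * G b := by
  classical
  have h : ∑ b ∈ Finset.univ.image (fun u : (ZMod d)ˣ ↦ (u : ZMod d)), χ b * G b =
      ∑ u : (ZMod d)ˣ, χ u * G u := Finset.sum_image fun u _ v _ h ↦ Units.ext h
  rw [← h]
  refine Finset.sum_subset (Finset.subset_univ _) fun b _ hb ↦ ?_
  rw [χ.map_nonunit fun ⟨u, hu⟩ ↦ hb (by simpa using ⟨u, hu⟩), zero_mul]

/-- Averaging a function of period `d ∣ c` against a character modulo `c`: the average vanishes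
unless the conductor divides `d`. -/
theorem sum_units_char_mul_comp_unitsMap {c d : ℕ} [NeZero c] [NeZero d]
    (ψ : DirichletCharacter ℂ c) (hdc : d ∣ c) (k : (ZMod d)ˣ) (G : ZMod d → ℂ) :
    ∑ a : (ZMod c)ˣ, ψ a * G (ZMod.unitsMap hdc a * k) =
      if h : ψ.conductor ∣ d then
        (c.totient : ℂ) / d.totient * ((changeLevel h ψ.primitiveCharacter)⁻¹ k *
          ∑ b : ZMod d, changeLevel h ψ.primitiveCharacter b * G b)
      else 0 := by
  split_ifs with h
  · have hψ (a : (ZMod c)ˣ) : ψ a = changeLevel h ψ.primitiveCharacter (ZMod.unitsMap hdc a) := by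
      conv_lhs => rw [← ψ.changeLevel_primitiveCharacter, changeLevel_trans _ h hdc]
      rw [changeLevel_eq_cast_of_dvd, ZMod.unitsMap_val]
    simp_rw [hψ]
    rw [sum_comp_surjective (ZMod.unitsMap_surjective hdc)
      (fun u ↦ changeLevel h ψ.primitiveCharacter u * G (u * k)), ZMod.card_units_eq_totient,
      ZMod.card_units_eq_totient, ← sum_units_char_mul, ← Equiv.sum_comp (Equiv.mulRight k⁻¹)]
    congr 1
    rw [Finset.mul_sum]
    refine Finset.sum_congr rfl fun u _ ↦ ?_
    rw [Equiv.coe_mulRight, Units.val_mul, mul_assoc, Units.inv_mul, mul_one, map_mul,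
      MulChar.inv_apply, Ring.inverse_unit]
    ring
  · -- Some unit in the kernel of reduction modulo `d` has a nontrivial value.
    have hnf : ¬ ψ.FactorsThrough d := fun hf ↦ h (conductor_dvd_of_mem_conductorSet ψ hf)
    rw [factorsThrough_iff_ker_unitsMap hdc] at hnf
    obtain ⟨u, hu, hu1⟩ := SetLike.not_le_iff_exists.mp hnf
    rw [MonoidHom.mem_ker] at hu hu1
    have hu1' : ψ u ≠ 1 := fun h ↦ hu1 (Units.ext (by simpa using h))
    refine eq_zero_of_mul_eq_self_left hu1' ?_
    rw [Finset.mul_sum]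
    refine Eq.trans (Finset.sum_congr rfl fun a _ ↦ ?_) (Equiv.sum_comp (Equiv.mulLeft u) _)
    rw [Equiv.coe_mulLeft, map_mul, hu, one_mul, Units.val_mul, map_mul, mul_assoc]

end DedekindSum

/-! ### The coefficients of the Dedekind sum -/

namespace DedekindSum
open Complex DirichletCharacter

/-- Sorting the residues `j` modulo `c` by their greatest common divisor `c / d` with `c`. -/
lemma sum_range_eq_sum_divisors_coprime {c : ℕ} (hc : c ≠ 0) (F : ℕ → ℂ) :
    ∑ j ∈ Finset.range c, F j =
      ∑ d ∈ c.divisors, ∑ k ∈ Finset.range d with k.Coprime d, F (c / d * k) := by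
  have hmaps : ∀ j ∈ Finset.range c, c / c.gcd j ∈ c.divisors := fun j _ ↦
    Nat.mem_divisors.mpr ⟨Nat.div_dvd_of_dvd (Nat.gcd_dvd_left c j), hc⟩
  rw [← Finset.sum_fiberwise_of_maps_to hmaps]
  refine Finset.sum_congr rfl fun d hd ↦ ?_
  obtain ⟨e, rfl⟩ := Nat.dvd_of_mem_divisors hd
  have he0 : 0 < e := Nat.pos_of_ne_zero fun h ↦ hc (by simp [h])
  have hd0 : 0 < d := Nat.pos_of_ne_zero fun h ↦ hc (by simp [h])
  rw [Nat.mul_div_cancel_left _ hd0]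
  refine (Finset.sum_nbij (e * ·) ?_ ?_ ?_ ?_).symm
  · intro k hk
    simp only [Finset.mem_range, Finset.mem_filter] at hk ⊢
    refine ⟨by nlinarith, ?_⟩
    rw [mul_comm d e, Nat.gcd_mul_left, Nat.gcd_comm, Nat.Coprime.gcd_eq_one hk.2, mul_one,
      Nat.mul_div_cancel_left _ he0]
  · intro a _ b _ h
    exact Nat.eq_of_mul_eq_mul_left he0 h
  · intro j hj
    simp only [Finset.coe_filter, Finset.mem_range, Set.mem_ofPred_eq] at hj
    have hg : (d * e).gcd j = e := by
      have h1 := Nat.div_mul_cancel (Nat.gcd_dvd_left (d * e) j)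
      rw [hj.2] at h1
      exact Nat.eq_of_mul_eq_mul_left hd0 h1
    obtain ⟨k, rfl⟩ : e ∣ j := hg ▸ Nat.gcd_dvd_right (d * e) j
    rw [mul_comm d e, Nat.gcd_mul_left] at hg
    refine ⟨k, ?_, rfl⟩
    simp only [Finset.coe_filter, Finset.mem_range, Set.mem_ofPred_eq]
    refine ⟨by nlinarith [hj.1], ?_⟩
    rw [Nat.coprime_comm]
    exact Nat.eq_of_mul_eq_mul_left he0 (by rw [hg, mul_one])
  · intro k _
    rfl

lemma starRingEnd_apply_eq_inv {q : ℕ} [NeZero q] (χ : DirichletCharacter ℂ q) (x : ZMod q) :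
    starRingEnd ℂ (χ x) = χ⁻¹ x := MulChar.star_apply' χ x

variable {q₁ q₂ c : ℕ} [NeZero q₁] [NeZero q₂]

/-- The inner sum `∑ n, conj χ(n) B₁(n/q₁ + x)` of the Dedekind sum, as a function of `x` on the
circle. The conjugate of a character is written as its inverse. -/
noncomputable def innerSum (χ : DirichletCharacter ℂ q₁) (x : UnitAddCircle) : ℂ :=
  ∑ n : ZMod q₁, χ⁻¹ n * (circleB₁ (ZMod.toAddCircle n + x) : ℂ)

lemma innerSum_neg (χ : DirichletCharacter ℂ q₁) (x : UnitAddCircle) :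
    innerSum χ (-x) = -(χ (-1)) * innerSum χ x := by
  rw [innerSum, innerSum, ← Equiv.sum_comp (Equiv.neg (ZMod q₁)), Finset.mul_sum]
  refine Finset.sum_congr rfl fun n _ ↦ ?_
  rw [Equiv.neg_apply, map_neg ZMod.toAddCircle n, ← neg_add, circleB₁_neg, map_neg_eq,
    inv_apply_neg_one]
  push_cast
  ring

lemma S_eq_sum_innerSum (χ₁ : DirichletCharacter ℂ q₁) (χ₂ : DirichletCharacter ℂ q₂) (a : ℤ) :
    S χ₁ χ₂ a c = ∑ j ∈ Finset.range c, χ₂⁻¹ j *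
      (circleB₁ ((j / c : ℝ) : UnitAddCircle) : ℂ) *
        innerSum χ₁ ((a * j / c : ℝ) : UnitAddCircle) := by
  rw [S]
  refine Finset.sum_congr rfl fun j _ ↦ ?_
  rw [sum_range_eq_sum_zmod, innerSum, Finset.mul_sum]
  refine Finset.sum_congr rfl fun n _ ↦ ?_
  rw [starRingEnd_apply_eq_inv, starRingEnd_apply_eq_inv, ZMod.natCast_zmod_val,
    ZMod.toAddCircle_apply, ← AddCircle.coe_add, circleB₁_coe, circleB₁_coe]
  push_cast
  ring

variable [NeZero c]

lemma S_eq_sum_divisors (χ₁ : DirichletCharacter ℂ q₁) (χ₂ : DirichletCharacter ℂ q₂) (a : ℤ) :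
    S χ₁ χ₂ a c = ∑ d ∈ c.divisors, χ₂⁻¹ (c / d : ℕ) *
      ∑ k ∈ Finset.range d with k.Coprime d, χ₂⁻¹ k *
        (circleB₁ ((k / d : ℝ) : UnitAddCircle) : ℂ) *
          innerSum χ₁ ((a * k / d : ℝ) : UnitAddCircle) := by
  rw [S_eq_sum_innerSum, sum_range_eq_sum_divisors_coprime (NeZero.ne c)]
  refine Finset.sum_congr rfl fun d hd ↦ ?_
  rw [Finset.mul_sum]
  refine Finset.sum_congr rfl fun k _ ↦ ?_
  obtain ⟨e, he⟩ := Nat.dvd_of_mem_divisors hd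
  have hc := NeZero.ne c
  have he0 : e ≠ 0 := fun h ↦ hc (by simp [he, h])
  have hd0 : d ≠ 0 := fun h ↦ hc (by simp [he, h])
  rw [he, Nat.mul_div_cancel_left _ (Nat.pos_of_ne_zero hd0)]
  have h1 : ((e * k : ℕ) : ℝ) / (d * e : ℕ) = k / d := by push_cast; field_simp
  have h2 : (a : ℝ) * (e * k : ℕ) / (d * e : ℕ) = a * k / d := by push_cast; field_simp
  rw [h1, h2, Nat.cast_mul, map_mul]
  ring

/-- The coefficient `∑ ψ(a) S(a, c)` of the Dedekind sum at the character `ψ`, the sum being over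
the units `a` modulo `c`, each represented by its residue in `[0, c)`. -/
noncomputable def coeff (χ₁ : DirichletCharacter ℂ q₁) (χ₂ : DirichletCharacter ℂ q₂)
    (ψ : DirichletCharacter ℂ c) : ℂ :=
  ∑ a : (ZMod c)ˣ, ψ a * S χ₁ χ₂ (((a : ZMod c).val : ℕ) : ℤ) c

/-- The coefficient with the sum over `a` innermost; that sum depends on `k` only through a
character value, by `sum_units_char_mul_innerSum`. -/
lemma coeff_eq_sum_divisors (χ₁ : DirichletCharacter ℂ q₁) (χ₂ : DirichletCharacter ℂ q₂)
    (ψ : DirichletCharacter ℂ c) :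
    coeff χ₁ χ₂ ψ = ∑ d ∈ c.divisors, χ₂⁻¹ (c / d : ℕ) *
      ∑ k ∈ Finset.range d with k.Coprime d, χ₂⁻¹ k *
        (circleB₁ ((k / d : ℝ) : UnitAddCircle) : ℂ) *
          ∑ a : (ZMod c)ˣ, ψ a *
            innerSum χ₁ (((a : ZMod c).val * k / d : ℝ) : UnitAddCircle) := by
  simp only [coeff, S_eq_sum_divisors, Finset.mul_sum, Int.cast_natCast]
  rw [Finset.sum_comm]
  refine Finset.sum_congr rfl fun d _ ↦ ?_
  rw [Finset.sum_comm]
  exact Finset.sum_congr rfl fun k _ ↦ Finset.sum_congr rfl fun a _ ↦ by ring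

lemma sum_units_char_mul_innerSum (χ : DirichletCharacter ℂ q₁) (ψ : DirichletCharacter ℂ c)
    {d k : ℕ} [NeZero d] (hdc : d ∣ c) (hk : k.Coprime d) :
    ∑ a : (ZMod c)ˣ, ψ a * innerSum χ (((a : ZMod c).val * k / d : ℝ) : UnitAddCircle) =
      if h : ψ.conductor ∣ d then
        (c.totient : ℂ) / d.totient * ((changeLevel h ψ.primitiveCharacter)⁻¹ k *
          ∑ b : ZMod d, changeLevel h ψ.primitiveCharacter b * innerSum χ (ZMod.toAddCircle b))
      else 0 := by
  have := sum_units_char_mul_comp_unitsMap ψ hdc (ZMod.unitOfCoprime k hk)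
    fun x ↦ innerSum χ (ZMod.toAddCircle x)
  rw [ZMod.coe_unitOfCoprime] at this
  rw [← this]
  refine Finset.sum_congr rfl fun a _ ↦ ?_
  have h : (((ZMod.unitsMap hdc a : (ZMod d)ˣ) : ZMod d) * k) =
      (((a : ZMod c).val * k : ℕ) : ZMod d) := by
    rw [ZMod.unitsMap_val, Nat.cast_mul, ZMod.natCast_val]
  rw [h, ZMod.toAddCircle_natCast, Nat.cast_mul]

/-- The contribution of a divisor `d` of `c` to the coefficient. The variables `k` and `b = a * k`
separate, so that it is a product of a generalized Bernoulli number for `conj (ψ χ₂)` and a sum of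
`innerSum χ₁` against `ψ`. -/
lemma divisor_term_eq {χ₁ : DirichletCharacter ℂ q₁} {χ₂ : DirichletCharacter ℂ q₂}
    (hχ₁ : χ₁.IsPrimitive) (hpar : χ₁ (-1) * χ₂ (-1) = 1) {ψ : DirichletCharacter ℂ c}
    (hψ : ψ (-1) * χ₁ (-1) = -1) {d : ℕ} [NeZero d] (hdc : d ∣ c) (hq₂ : q₂ ∣ d)
    (hcond : ψ.conductor ∣ d) :
    Real.pi ^ 2 * ∑ k ∈ Finset.range d with k.Coprime d, χ₂⁻¹ k *
        (circleB₁ ((k / d : ℝ) : UnitAddCircle) : ℂ) *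
          ∑ a : (ZMod c)ˣ, ψ a *
            innerSum χ₁ (((a : ZMod c).val * k / d : ℝ) : UnitAddCircle) =
      -((c.totient : ℂ) * (ψ⁻¹.primitiveCharacter.mul χ₁).LFunction 1 *
        (ψ.mul χ₂).primitiveCharacter.LFunction 1) *
      (tau (ψ.mul χ₂)⁻¹.primitiveCharacter * tau ψ.primitiveCharacter * tau χ₁⁻¹ *
        ((d.totient : ℂ)⁻¹ *
        LSeries.convolution
          (fun n : ℕ => (ψ.mul χ₂)⁻¹.primitiveCharacter (n : ZMod _) * ((μ n : ℤ) : ℂ))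
          (fun _ => 1) d *
        LSeries.convolution
          (fun n : ℕ => χ₁ (n : ZMod q₁))
          (fun n : ℕ => ((μ n : ℤ) : ℂ) * ψ.primitiveCharacter (n : ZMod _))
          (d / ψ.conductor))) := by
  obtain ⟨hθd, hθ⟩ := exists_changeLevel_primitiveCharacter_mul_inv ψ χ₂ hdc hcond hq₂
  have hodd₂ : (ψ.mul χ₂)⁻¹.primitiveCharacter (-1) = -1 := by
    rw [primitiveCharacter_neg_one, inv_apply_neg_one, DirichletCharacter.mul, MulChar.mul_apply,
      changeLevel_neg_one, changeLevel_neg_one]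
    have h1 : χ₁ (-1) * χ₁ (-1) = 1 := by rw [← map_mul]; simp
    linear_combination (-(ψ (-1)) * χ₂ (-1)) * h1 + (ψ (-1) * χ₁ (-1)) * hpar + hψ
  have hA := pi_mul_sum_changeLevel_mul_circleB₁ hθd
    (primitiveCharacter_isPrimitive (ψ.mul χ₂)⁻¹) (Ξ := (ψ.mul χ₂).primitiveCharacter)
    (fun n ↦ by rw [← primitiveCharacter_inv_natCast, inv_inv]) hodd₂
  have hB := pi_mul_sum_changeLevel_mul_sum_circleB₁ hcond hχ₁ (primitiveCharacter_isPrimitive ψ)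
    (Ξ := ψ⁻¹.primitiveCharacter.mul χ₁)
    (fun n ↦ by rw [mul_natCast, primitiveCharacter_inv_natCast, mul_comm])
    (by rw [primitiveCharacter_neg_one, hψ])
  have hsum : ∑ k ∈ Finset.range d with k.Coprime d, χ₂⁻¹ k *
        (circleB₁ ((k / d : ℝ) : UnitAddCircle) : ℂ) *
        (changeLevel hcond ψ.primitiveCharacter)⁻¹ k =
      ∑ k : ZMod d, changeLevel hθd (ψ.mul χ₂)⁻¹.primitiveCharacter k *
        (circleB₁ (ZMod.toAddCircle k) : ℂ) := by
    have h1 := sum_range_eq_sum_zmod d fun k ↦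
      changeLevel hθd (ψ.mul χ₂)⁻¹.primitiveCharacter (k : ZMod d) *
        (circleB₁ ((k / d : ℝ) : UnitAddCircle) : ℂ)
    simp only [ZMod.natCast_zmod_val, ← ZMod.toAddCircle_apply] at h1
    rw [← h1, Finset.sum_filter]
    refine Finset.sum_congr rfl fun k _ ↦ ?_
    split_ifs with hk
    · rw [hθ, MulChar.mul_apply, ← map_inv (changeLevel hq₂),
        changeLevel_natCast_of_coprime hq₂ _ hk]
      ring
    · rw [eq_zero_of_not_coprime _ hk, zero_mul]
  have hterm : ∑ k ∈ Finset.range d with k.Coprime d, χ₂⁻¹ k *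
        (circleB₁ ((k / d : ℝ) : UnitAddCircle) : ℂ) *
          ∑ a : (ZMod c)ˣ, ψ a *
            innerSum χ₁ (((a : ZMod c).val * k / d : ℝ) : UnitAddCircle) =
      (∑ k ∈ Finset.range d with k.Coprime d, χ₂⁻¹ k *
        (circleB₁ ((k / d : ℝ) : UnitAddCircle) : ℂ) *
        (changeLevel hcond ψ.primitiveCharacter)⁻¹ k) * ((c.totient : ℂ) / d.totient *
          ∑ b : ZMod d, changeLevel hcond ψ.primitiveCharacter b *
            innerSum χ₁ (ZMod.toAddCircle b)) := by
    rw [Finset.sum_mul]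
    refine Finset.sum_congr rfl fun k hk ↦ ?_
    rw [sum_units_char_mul_innerSum _ _ hdc (Finset.mem_filter.mp hk).2, dif_pos hcond]
    ring
  rw [hterm, hsum]
  simp only [innerSum]
  generalize (∑ k : ZMod d, changeLevel hθd (ψ.mul χ₂)⁻¹.primitiveCharacter k *
    (circleB₁ (ZMod.toAddCircle k) : ℂ)) = A at hA ⊢
  generalize (∑ b : ZMod d, changeLevel hcond ψ.primitiveCharacter b * ∑ n : ZMod q₁, χ₁⁻¹ n *
    (circleB₁ (ZMod.toAddCircle n + ZMod.toAddCircle b) : ℂ)) = B at hB ⊢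
  calc _ = (c.totient : ℂ) / d.totient * ((Real.pi * A) * (Real.pi * B)) := by ring
    _ = _ := by
      rw [hA, hB]
      linear_combination (c.totient : ℂ) / d.totient *
        (tau (ψ.mul χ₂)⁻¹.primitiveCharacter * LSeries.convolution
          (fun n : ℕ => (ψ.mul χ₂)⁻¹.primitiveCharacter (n : ZMod _) * ((μ n : ℤ) : ℂ))
          (fun _ => 1) d * (ψ.mul χ₂).primitiveCharacter.LFunction 1) *
        (tau ψ.primitiveCharacter * tau χ₁⁻¹ * LSeries.convolution
          (fun n : ℕ => χ₁ (n : ZMod q₁))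
          (fun n : ℕ => ((μ n : ℤ) : ℂ) * ψ.primitiveCharacter (n : ZMod _))
          (d / ψ.conductor) * (ψ⁻¹.primitiveCharacter.mul χ₁).LFunction 1) * I_sq

/-- The coefficient at a character `ψ` with `ψ χ₁` odd. -/
theorem pi_sq_mul_coeff {χ₁ : DirichletCharacter ℂ q₁} {χ₂ : DirichletCharacter ℂ q₂}
    (hχ₁ : χ₁.IsPrimitive) (hpar : χ₁ (-1) * χ₂ (-1) = 1) (hc : q₂ ∣ c)
    {ψ : DirichletCharacter ℂ c} (hψ : ψ (-1) * χ₁ (-1) = -1) :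
    Real.pi ^ 2 * coeff χ₁ χ₂ ψ =
      -((c.totient : ℂ) * (ψ⁻¹.primitiveCharacter.mul χ₁).LFunction 1 *
        (ψ.mul χ₂).primitiveCharacter.LFunction 1) * g χ₁ χ₂ ψ := by
  rw [coeff_eq_sum_divisors, g, Finset.sum_filter, Finset.mul_sum, Finset.mul_sum, Finset.mul_sum]
  refine Finset.sum_congr rfl fun d hd ↦ ?_
  have hdc := Nat.dvd_of_mem_divisors hd
  have : NeZero d := ⟨fun h ↦ NeZero.ne c (by simpa [h] using hdc)⟩
  rw [starRingEnd_apply_eq_inv]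
  split_ifs with hcond
  · by_cases hq₂ : q₂ ∣ d
    · rw [mul_left_comm, divisor_term_eq hχ₁ hpar hψ hdc hq₂ hcond]
      ring
    · -- `χ₂ (c / d)` vanishes, since `q₂` divides `c = (c / d) * d` but not `d`.
      have hcop : ¬ (c / d).Coprime q₂ := fun h ↦ hq₂ (h.symm.dvd_of_dvd_mul_left
        (by rwa [Nat.div_mul_cancel hdc]))
      rw [eq_zero_of_not_coprime χ₂⁻¹ hcop]
      ring
  · rw [Finset.sum_eq_zero, mul_zero, mul_zero, mul_zero, mul_zero]
    intro k hk
    rw [sum_units_char_mul_innerSum _ _ hdc (Finset.mem_filter.mp hk).2, dif_neg hcond, mul_zero]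

/-- As a function of `a`, the Dedekind sum has the parity opposite to that of `χ₁`, because `B₁` is
odd; hence its coefficients at characters of the parity of `χ₁` vanish. -/
theorem coeff_eq_zero (χ₁ : DirichletCharacter ℂ q₁) (χ₂ : DirichletCharacter ℂ q₂)
    {ψ : DirichletCharacter ℂ c} (hψ : ψ (-1) * χ₁ (-1) ≠ -1) : coeff χ₁ χ₂ ψ = 0 := by
  have hψ1 : ψ (-1) * χ₁ (-1) = 1 := by
    have h1 : χ₁ (-1) * χ₁ (-1) = 1 := by rw [← map_mul]; simp
    have h2 : ψ (-1) * ψ (-1) = 1 := by rw [← map_mul]; simp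
    have h3 : (ψ (-1) * χ₁ (-1)) * (ψ (-1) * χ₁ (-1)) = 1 := by
      linear_combination χ₁ (-1) * χ₁ (-1) * h2 + h1
    exact (mul_self_eq_one_iff.mp h3).resolve_right hψ
  have hval (j : ℕ) (a : ZMod c) : ((((a.val : ℕ) : ℤ) * j / c : ℝ) : UnitAddCircle) =
      ZMod.toAddCircle (a * (j : ZMod c)) := by
    have h : a * (j : ZMod c) = ((a.val * j : ℕ) : ZMod c) := by simp
    rw [h, ZMod.toAddCircle_natCast]
    push_cast
    rfl
  have hS (a : (ZMod c)ˣ) : S χ₁ χ₂ (((-a : (ZMod c)ˣ) : ZMod c).val : ℤ) c =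
      -(χ₁ (-1)) * S χ₁ χ₂ ((a : ZMod c).val : ℤ) c := by
    rw [S_eq_sum_innerSum, S_eq_sum_innerSum, Finset.mul_sum]
    refine Finset.sum_congr rfl fun j _ ↦ ?_
    rw [hval, hval, Units.val_neg, neg_mul,
      map_neg ZMod.toAddCircle ((a : ZMod c) * (j : ZMod c)), innerSum_neg]
    ring
  have h : coeff χ₁ χ₂ ψ = -coeff χ₁ χ₂ ψ := by
    conv_lhs => rw [coeff, ← Equiv.sum_comp (Equiv.neg _)]
    rw [coeff, ← Finset.sum_neg_distrib]
    refine Finset.sum_congr rfl fun a _ ↦ ?_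
    rw [Equiv.neg_apply, hS, Units.val_neg, map_neg_eq]
    linear_combination -(ψ a * S χ₁ χ₂ ((a : ZMod c).val : ℤ) c) * hψ1
  exact self_eq_neg.mp h

/-- Parseval's identity for the group of units modulo `c`. -/
theorem sum_norm_sq_eq_sum_characters (f : (ZMod c)ˣ → ℂ) :
    ∑ ψ : DirichletCharacter ℂ c, ‖∑ a : (ZMod c)ˣ, ψ a * f a‖ ^ 2 =
      c.totient * ∑ a : (ZMod c)ˣ, ‖f a‖ ^ 2 := by
  have hC : ∑ ψ : DirichletCharacter ℂ c,
      (∑ a : (ZMod c)ˣ, ψ a * f a) * starRingEnd ℂ (∑ a : (ZMod c)ˣ, ψ a * f a) =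
      c.totient * ∑ a : (ZMod c)ˣ, f a * starRingEnd ℂ (f a) := by
    simp only [map_sum, map_mul, Finset.sum_mul_sum]
    rw [Finset.sum_comm, Finset.mul_sum]
    refine Finset.sum_congr rfl fun a _ ↦ ?_
    rw [Finset.sum_comm]
    have hb (b : (ZMod c)ˣ) : ∑ ψ : DirichletCharacter ℂ c,
        ψ a * f a * (starRingEnd ℂ (ψ b) * starRingEnd ℂ (f b)) =
        if (b : ZMod c) = a then c.totient * (f a * starRingEnd ℂ (f b)) else 0 := by
      have h := sum_char_inv_mul_char_eq ℂ b.isUnit (a : ZMod c)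
      calc _ = (∑ ψ : DirichletCharacter ℂ c, ψ (b : ZMod c)⁻¹ * ψ a) *
            (f a * starRingEnd ℂ (f b)) := by
            rw [Finset.sum_mul]
            refine Finset.sum_congr rfl fun ψ _ ↦ ?_
            rw [starRingEnd_apply_eq_inv, MulChar.inv_apply, Ring.inverse_unit, ZMod.inv_coe_unit]
            ring
        _ = _ := by rw [h]; split_ifs <;> simp
    simp only [hb, Units.val_inj, Finset.sum_ite_eq', Finset.mem_univ, if_true]
  simp only [Complex.mul_conj, Complex.normSq_eq_norm_sq] at hC
  exact_mod_cast hC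

lemma sum_coprime_range_eq_sum_units (F : ℕ → ℝ) :
    ∑ a ∈ Finset.range c with a.Coprime c, F a = ∑ a : (ZMod c)ˣ, F (a : ZMod c).val := by
  symm
  refine Finset.sum_bij (fun a _ ↦ (a : ZMod c).val) ?_ ?_ ?_ ?_
  · intro a _
    exact Finset.mem_filter.mpr ⟨Finset.mem_range.mpr (ZMod.val_lt _), ZMod.val_coe_unit_coprime a⟩
  · intro a _ b _ h
    exact Units.ext (ZMod.val_injective c h)
  · intro a ha
    obtain ⟨h1, h2⟩ := Finset.mem_filter.mp ha
    refine ⟨ZMod.unitOfCoprime a h2, Finset.mem_univ _, ?_⟩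
    rw [ZMod.coe_unitOfCoprime, ZMod.val_cast_of_lt (Finset.mem_range.mp h1)]
  · intro a _
    rfl

end DedekindSum

theorem mainTheorem1 (q₁ q₂ c : ℕ) [NeZero q₁] [NeZero q₂] [NeZero c]
    (χ₁ : DirichletCharacter ℂ q₁) (χ₂ : DirichletCharacter ℂ q₂)
    (hχ₁ : χ₁.IsPrimitive) (hχ₂ : χ₂.IsPrimitive) (hχ₁_ne : χ₁ ≠ 1) (hχ₂_ne : χ₂ ≠ 1)
    (hpar : χ₁ (-1) * χ₂ (-1) = 1) (hc : q₁ * q₂ ∣ c) :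
    ((∑ a ∈ Finset.range c with a.Coprime c, ‖DedekindSum.S χ₁ χ₂ (a : ℤ) c‖ ^ 2 : ℝ)) =
      (c.totient : ℝ) / Real.pi ^ 4 *
        ∑ ψ : DirichletCharacter ℂ c with ψ (-1) * χ₁ (-1) = -1,
          ‖(ψ⁻¹.primitiveCharacter.mul χ₁).LFunction 1‖ ^ 2 *
            ‖(ψ.mul χ₂).primitiveCharacter.LFunction 1‖ ^ 2 *
            ‖DedekindSum.g χ₁ χ₂ ψ‖ ^ 2 := by
  have hpi : Real.pi ≠ 0 := Real.pi_ne_zero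
  have hφ : (c.totient : ℝ) ≠ 0 := by
    exact_mod_cast (Nat.totient_pos.mpr (NeZero.pos c)).ne'
  rw [DedekindSum.sum_coprime_range_eq_sum_units
    (fun a ↦ ‖DedekindSum.S χ₁ χ₂ (a : ℤ) c‖ ^ 2)]
  have h := DedekindSum.sum_norm_sq_eq_sum_characters (c := c)
    fun a ↦ DedekindSum.S χ₁ χ₂ (((a : ZMod c).val : ℕ) : ℤ) c
  rw [← mul_right_inj' hφ, ← h, Finset.sum_filter, Finset.mul_sum, Finset.mul_sum]
  refine Finset.sum_congr rfl fun ψ _ ↦ ?_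
  change ‖DedekindSum.coeff χ₁ χ₂ ψ‖ ^ 2 = _
  split_ifs with hψ
  · have key := congrArg (fun z : ℂ ↦ ‖z‖ ^ 2)
      (DedekindSum.pi_sq_mul_coeff hχ₁ hpar ((dvd_mul_left q₂ q₁).trans hc) hψ)
    simp only [norm_mul, norm_neg, norm_pow, Complex.norm_real, Complex.norm_natCast, mul_pow,
      Real.norm_eq_abs, sq_abs] at key
    field_simp
    linear_combination key
  · rw [DedekindSum.coeff_eq_zero χ₁ χ₂ hψ]
    simp
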